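/- Theorem (Reformulation with piecewise affine loss functions). Let $H,I,J\ge 1$, let $\|\cdot\|$ be an arbitrary norm on $\mathbb{R}^M$ with dual norm $\|v\|_*=\sup_{\|u\|\le 1}\langle v,u\rangle$, let $\Xi=\{\xi\in\mathbb{R}^M: C\xi\le g\}$, let $\mathbb{X}\subseteq\mathbb{R}^K$, and let $\ell(x,\xi)=\max_{j\in[J]}\{\langle a_j(x),\xi\rangle+b_j(x)\}$ with $a_j(x)\in\mathbb{R}^M$, $b_j(x)\in\mathbb{R}$ linear (possibly with a constant term, i.e. affine) in $x$. Let $\hat\xi_h^{(i)}\in\mathbb{R}^M$ ($h\in[H]$, $i\in[I]$), let $t_h\ge 0$ with $\sum_h t_h=1$, and suppose that $\hat{\mathbb{P}}=\sum_{h}\frac{t_h}{I}\sum_{i}\delta_{\hat\xi_h^{(i)}}$ is supported on $\Xi$. For $\varepsilon\ge 0$ let $\mathbb{B}_\varepsilon(\hat{\mathbb{P}})$ be the set of probability distributions $\mathbb{Q}$ on $\Xi$ with $\mathbb{E}^{\mathbb{Q}}\|\xi\|<\infty$ and $\inf_\Pi\int_{\Xi^2}\|\xi-\xi'\|\,\Pi(d\xi,d\xi')\le\varepsilon$,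 the infimum being over joint distributions $\Pi$ on $\Xi^2$ with marginals $\mathbb{Q}$ and $\hat{\mathbb{P}}$. Then the multi-reference distributionally robust problem $$\inf_{x\in\mathbb{X}}\ \sup_{\mathbb{Q}\in\mathbb{B}_\varepsilon(\hat{\mathbb{P}})}\mathbb{E}^{\mathbb{Q}}[\ell(x,\xi)]$$ is equivalent to the finite program $$\begin{aligned}\inf_{x,\lambda,s_{hi},\gamma_{hij}}\quad&\lambda\varepsilon+\sum_{h=1}^{H}\sum_{i=1}^{I}\frac{t_h}{I}s_{hi}\\ \text{s.t.}\quad& x\in\mathbb{X},\\& b_j(x)+\langle a_j(x),\hat\xi_h^{(i)}\rangle+\langle\gamma_{hij},g-C\hat\xi_h^{(i)}\rangle\le s_{hi},\\&\|C^{\mathsf T}\gamma_{hij}-a_j(x)\|_*\le\lambda,\qquad \gamma_{hij}\ge 0,\qquad \forall h\in[H],\,i\in[I],\,j\in[J].\end{aligned}$$ That is: the two optimal values agree in $[-\infty,+\infty]$; for every fixed $x\in\mathbb{X}$ the worst-case expectation $\sup_{\mathbb{Q}}\mathbb{E}^{\mathbb{Q}}[\ell(x,\xi)]$ equals the infimum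 of the program over $(\lambda,s,\gamma)$ with that $x$; and $x$ is an optimal solution of the first problem if and only if it is the $x$-component of an optimal solution of the second. If $\|\cdot\|$ is the $\ell_1$ norm, then $\|\cdot\|_*$ is the $\ell_\infty$ norm, and if moreover $\mathbb{X}$ is given by finitely many linear inequalities, then the finite program is a linear program (a linear objective minimized over the solution set of finitely many linear inequalities). -/

import Mathlib

open MeasureTheory
open scoped Matrix ENNReal

noncomputable section

namespace MRDRO

/-- The uncertainty set `Ξ = {ξ ∈ ℝ^M : C ξ ≤ g}`. -/
def uncertaintySet {M R : ℕ} (C : Matrix (Fin R) (Fin M) ℝ) (g : Fin R → ℝ) :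
    Set (Fin M → ℝ) :=
  {ξ | C *ᵥ ξ ≤ g}

/-- The piecewise affine loss `ℓ(x, ξ) = max_j (⟨a_j(x), ξ⟩ + b_j(x))`. -/
def loss {K M J : ℕ} [NeZero J]
    (a : Fin J → (Fin K → ℝ) →ᵃ[ℝ] (Fin M → ℝ)) (b : Fin J → (Fin K → ℝ) →ᵃ[ℝ] ℝ)
    (x : Fin K → ℝ) (ξ : Fin M → ℝ) : ℝ :=
  Finset.univ.sup' Finset.univ_nonempty fun j => a j x ⬝ᵥ ξ + b j x

/-- The trust-weighted empirical distribution `∑_h (t_h / I) ∑_i δ_{ξ̂_h^{(i)}}`. -/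
def empirical {M H I : ℕ} (t : Fin H → ℝ) (ξhat : Fin H → Fin I → Fin M → ℝ) :
    Measure (Fin M → ℝ) :=
  ∑ h, ∑ i, ENNReal.ofReal (t h / (I : ℝ)) • Measure.dirac (ξhat h i)

/-- `ℳ(Ξ)`: Borel probability measures concentrated on `Ξ` with finite first moment
with respect to the norm `N`. -/
def distributions {M : ℕ} (N : Seminorm ℝ (Fin M → ℝ)) (Ξ : Set (Fin M → ℝ)) :
    Set (Measure (Fin M → ℝ)) :=
  {Q | IsProbabilityMeasure Q ∧ Q Ξᶜ = 0 ∧ ∫⁻ ξ in Ξ, ENNReal.ofReal (N ξ) ∂Q < ⊤}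

/-- Joint distributions on `Ξ × Ξ` with first marginal `Q` and second marginal `P`. -/
def couplings {M : ℕ} (Ξ : Set (Fin M → ℝ)) (Q P : Measure (Fin M → ℝ)) :
    Set (Measure ((Fin M → ℝ) × (Fin M → ℝ))) :=
  {π | π (Ξ ×ˢ Ξ)ᶜ = 0 ∧ π.map Prod.fst = Q ∧ π.map Prod.snd = P}

/-- The (type-1) Wasserstein distance `d_W(P, Q)` for the norm `N`; the value is `∞` if there is
no coupling on `Ξ × Ξ`. -/
def wasserstein {M : ℕ} (N : Seminorm ℝ (Fin M → ℝ)) (Ξ : Set (Fin M → ℝ))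
    (P Q : Measure (Fin M → ℝ)) : ℝ≥0∞ :=
  ⨅ π ∈ couplings Ξ Q P, ∫⁻ z in Ξ ×ˢ Ξ, ENNReal.ofReal (N (z.1 - z.2)) ∂π

/-- The ambiguity set: distributions in `ℳ(Ξ)` at Wasserstein distance at most `ε` from `P`. -/
def ambiguitySet {M : ℕ} (N : Seminorm ℝ (Fin M → ℝ)) (Ξ : Set (Fin M → ℝ)) (ε : ℝ)
    (P : Measure (Fin M → ℝ)) : Set (Measure (Fin M → ℝ)) :=
  {Q | Q ∈ distributions N Ξ ∧ wasserstein N Ξ P Q ≤ ENNReal.ofReal ε}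

/-- The worst-case expectation `sup_{Q ∈ 𝔹_ε(P)} E^Q[f]` as an extended real number. For `f` of
at most linear growth every `E^Q[f]` is a finite, genuine integral. -/
def worstCase {M : ℕ} (N : Seminorm ℝ (Fin M → ℝ)) (Ξ : Set (Fin M → ℝ)) (ε : ℝ)
    (P : Measure (Fin M → ℝ)) (f : (Fin M → ℝ) → ℝ) : EReal :=
  ⨆ Q ∈ ambiguitySet N Ξ ε P, ((∫ ξ in Ξ, f ξ ∂Q : ℝ) : EReal)

/-- The dual norm `‖v‖_* = sup {⟨v, u⟩ : ‖u‖ ≤ 1}`. -/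
def dualNorm {M : ℕ} (N : Seminorm ℝ (Fin M → ℝ)) (v : Fin M → ℝ) : ℝ :=
  sSup {r : ℝ | ∃ u : Fin M → ℝ, N u ≤ 1 ∧ r = v ⬝ᵥ u}

/-- The auxiliary variables `(λ, s, γ)` of the finite program. -/
abbrev AuxVar (H I J R : ℕ) : Type :=
  ℝ × (Fin H → Fin I → ℝ) × (Fin H → Fin I → Fin J → Fin R → ℝ)

/-- The feasible set of the finite program, in the variables `(x, λ, s, γ)`. -/
def feasible {K M H I J R : ℕ} (N : Seminorm ℝ (Fin M → ℝ)) (X : Set (Fin K → ℝ))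
    (a : Fin J → (Fin K → ℝ) →ᵃ[ℝ] (Fin M → ℝ)) (b : Fin J → (Fin K → ℝ) →ᵃ[ℝ] ℝ)
    (C : Matrix (Fin R) (Fin M) ℝ) (g : Fin R → ℝ) (ξhat : Fin H → Fin I → Fin M → ℝ) :
    Set ((Fin K → ℝ) × AuxVar H I J R) :=
  {v | match v with
    | (x, lam, s, γ) => x ∈ X ∧ ∀ h i j,
        b j x + a j x ⬝ᵥ ξhat h i + γ h i j ⬝ᵥ (g - C *ᵥ ξhat h i) ≤ s h i ∧
        dualNorm N (Cᵀ *ᵥ γ h i j - a j x) ≤ lam ∧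
        0 ≤ γ h i j}

/-- The objective `λ ε + ∑_h ∑_i (t_h / I) s_{hi}` of the finite program. -/
def objective {K H I J R : ℕ} (t : Fin H → ℝ) (ε : ℝ) :
    (Fin K → ℝ) × AuxVar H I J R → ℝ :=
  fun (_, lam, s, _) => lam * ε + ∑ h, ∑ i, t h / (I : ℝ) * s h i

/-- A polyhedral set: the solution set of finitely many (non-strict) linear inequalities. -/
def IsPolyhedral {V : Type*} [AddCommGroup V] [Module ℝ V] (S : Set V) : Prop :=
  ∃ (n : ℕ) (f : Fin n → V →ₗ[ℝ] ℝ) (c : Fin n → ℝ), S = {v | ∀ k, f k v ≤ c k}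

/-- Minimizing `φ` over `S` is a linear program: `φ` is a linear functional and `S` is cut out by
finitely many linear inequalities. -/
def IsLinearProgram {V : Type*} [AddCommGroup V] [Module ℝ V] (S : Set V) (φ : V → ℝ) : Prop :=
  (∃ f : V →ₗ[ℝ] ℝ, ∀ v, φ v = f v) ∧ IsPolyhedral S

end MRDRO

end

/-! The reference measure is a finite sum of weighted atoms, so both halves of Kantorovich duality
reduce to finite-dimensional convexity, for each fixed `x`. Weak duality
(`integral_loss_le_of_feasible`): a feasible `(λ, s, γ)` yields a continuous `S` with `ℓ(ξ) ≤ λ‖ξ -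
ζ‖ + S ζ` for `ξ` in `Ξ` and `S ≤ s` at the atoms; integrating against nearly optimal couplings
bounds the expected loss. Strong duality with attainment (`exists_feasible_objective_le`): let `V`
bound the worst case. Moving atoms, or halves of split atoms, within the budget stays in the ball.
Splitting convexifies the choice of targets, so the budget has a Lagrange multiplier `λ`
(`exists_lagrange_multiplier`). The Lagrangian separates over atoms, which defines `s`
(`exists_sum_upperBounds_le`). Each affine piece of the loss then obeys a conjugate bound on a
polyhedron, and a Farkas-type separation turns it into `γ` (`exists_multiplier_of_conjugate_le`);
this rests on finitely generated cones being closed. Since the dual value is attained for every `x`,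
equality of values and the correspondence of minimizers follow. -/

namespace MRDRO

/-! ### Finitely generated cones are closed -/

/-- A point of the image of the nonnegative orthant has a nonnegative preimage on whose support
the linear map is injective (conic Carathéodory theorem). -/
theorem exists_nonneg_preimage_injOn_support {ι E : Type*} [Fintype ι]
    [AddCommGroup E] [Module ℝ E] (L : (ι → ℝ) →ₗ[ℝ] E) (γ : ι → ℝ) (hγ : 0 ≤ γ) :
    ∃ γ' : ι → ℝ, 0 ≤ γ' ∧ L γ' = L γ ∧
      ∀ η : ι → ℝ, (∀ i, γ' i = 0 → η i = 0) → L η = 0 → η = 0 := by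
  classical
  induction hn : (Finset.univ.filter fun i => γ i ≠ 0).card using Nat.strong_induction_on
    generalizing γ with
  | _ n ih =>
  by_cases hinj : ∀ η : ι → ℝ, (∀ i, γ i = 0 → η i = 0) → L η = 0 → η = 0
  · exact ⟨γ, hγ, rfl, hinj⟩
  push Not at hinj
  obtain ⟨η, hsupp, hL, hne⟩ := hinj
  obtain ⟨η, hsupp, hL, hpos⟩ : ∃ η : ι → ℝ, (∀ i, γ i = 0 → η i = 0) ∧ L η = 0 ∧
      ∃ i, 0 < η i := by
    obtain ⟨i, hi⟩ := Function.ne_iff.mp hne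
    rcases lt_or_gt_of_ne hi with h | h
    · exact ⟨-η, fun j hj => by simp [hsupp j hj], by simp [hL], i, by simpa using h⟩
    · exact ⟨η, hsupp, hL, i, h⟩
  -- Ratio test: `γ k / η k` is the longest step along `-η` that stays nonnegative, and it
  -- annihilates coordinate `k`. No new coordinate enters, so the support shrinks strictly.
  obtain ⟨k, hk, hmin⟩ := (Finset.univ.filter fun i => 0 < η i).exists_min_image
    (fun i => γ i / η i) (by obtain ⟨i, hi⟩ := hpos; exact ⟨i, by simpa using hi⟩)
  have hk' : 0 < η k := by simpa using hk
  set θ := γ k / η k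
  have hθ : 0 ≤ θ := div_nonneg (hγ k) hk'.le
  have hnonneg : 0 ≤ γ - θ • η := by
    intro i
    simp only [Pi.zero_apply, Pi.sub_apply, Pi.smul_apply, smul_eq_mul, sub_nonneg]
    by_cases hi : 0 < η i
    · exact (le_div_iff₀ hi).mp (hmin i (by simpa using hi))
    · exact (mul_nonpos_of_nonneg_of_nonpos hθ (not_lt.mp hi)).trans (hγ i)
  have hcard : (Finset.univ.filter fun i => (γ - θ • η) i ≠ 0).card < n := by
    rw [← hn]
    apply Finset.card_lt_card
    rw [Finset.ssubset_iff_of_subset]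
    · refine ⟨k, ?_, ?_⟩
      · simp only [Finset.mem_filter, Finset.mem_univ, true_and]
        intro h
        exact hk'.ne' (hsupp k h)
      · simp [θ, hk'.ne']
    · intro i
      simp only [Finset.mem_filter, Finset.mem_univ, true_and]
      intro h h0
      exact h (by simp [h0, hsupp i h0])
  obtain ⟨γ', h0, h1, h2⟩ := ih _ hcard _ hnonneg rfl
  exact ⟨γ', h0, by rw [h1]; simp [hL], h2⟩

/-- A linear map sends the nonnegative orthant to a closed cone. -/
theorem isClosed_image_nonneg {ι E : Type*} [Fintype ι] [NormedAddCommGroup E] [NormedSpace ℝ E]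
    (L : (ι → ℝ) →ₗ[ℝ] E) : IsClosed (L '' {γ | 0 ≤ γ}) := by
  classical
  let V : Set ι → Submodule ℝ (ι → ℝ) := fun s =>
    { carrier := {η | ∀ i ∉ s, η i = 0}
      add_mem' := fun ha hb i hi => by simp [ha i hi, hb i hi]
      zero_mem' := fun i _ => rfl
      smul_mem' := fun c x hx i hi => by simp [hx i hi] }
  -- By conic Carathéodory the image is a finite union of images of orthant faces on whose span `L`
  -- is injective; an injective linear map in finite dimension is a closed embedding.
  have key : L '' {γ | 0 ≤ γ} = ⋃ s ∈ {s : Set ι | Function.Injective (L.domRestrict (V s))},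
      (L.domRestrict (V s)) '' {γ | 0 ≤ (γ : ι → ℝ)} := by
    ext y
    simp only [Set.mem_image, Set.mem_iUnion, Set.mem_ofPred_eq, exists_prop]
    constructor
    · rintro ⟨γ, hγ, rfl⟩
      obtain ⟨γ', h0, h1, h2⟩ := exists_nonneg_preimage_injOn_support L γ hγ
      refine ⟨{i | γ' i ≠ 0}, ?_, ⟨γ', fun i hi => by simpa using hi⟩, h0, h1⟩
      rw [← LinearMap.ker_eq_bot, LinearMap.ker_eq_bot']
      rintro ⟨η, hη⟩ hL
      exact Subtype.ext (h2 η (fun i hi => hη i (by simpa using hi)) hL)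
    · rintro ⟨s, -, γ, hγ, rfl⟩
      exact ⟨γ, hγ, rfl⟩
  rw [key]
  refine (Set.toFinite _).isClosed_biUnion fun s hs => ?_
  refine (LinearMap.isClosedEmbedding_of_injective
    (LinearMap.ker_eq_bot.mpr hs)).isClosedMap _ ?_
  exact isClosed_le continuous_const continuous_subtype_val

/-! ### Norms on `ℝ^M` and the dual norm -/

theorem continuous_seminorm {M : ℕ} (N : Seminorm ℝ (Fin M → ℝ)) : Continuous N := by
  have := ConvexOn.continuousOn isOpen_univ N.convexOn
  rwa [continuousOn_univ] at this

/-- A norm on `ℝ^M` dominates a multiple of the supremum norm. -/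
theorem exists_norm_le_mul {M : ℕ} (N : Seminorm ℝ (Fin M → ℝ)) (hN : ∀ v, N v = 0 → v = 0) :
    ∃ c : ℝ, 0 ≤ c ∧ ∀ v, ‖v‖ ≤ c * N v := by
  rcases (Metric.sphere (0 : Fin M → ℝ) 1).eq_empty_or_nonempty with h | h
  · refine ⟨0, le_rfl, fun v => ?_⟩
    by_contra hv
    have hv' : ‖v‖ ≠ 0 := by intro h0; simp [h0] at hv
    have : (‖v‖⁻¹ • v) ∈ Metric.sphere (0 : Fin M → ℝ) 1 := by
      simp [norm_smul, hv']
    simp [h] at this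
  obtain ⟨u, hu, hmin⟩ := (isCompact_sphere (0 : Fin M → ℝ) 1).exists_isMinOn h
    (continuous_seminorm N).continuousOn
  have hu0 : 0 < N u := by
    refine lt_of_le_of_ne (apply_nonneg N u) fun h0 => ?_
    have := hN u h0.symm
    simp [this] at hu
  refine ⟨(N u)⁻¹, by positivity, fun v => ?_⟩
  by_cases hv : ‖v‖ = 0
  · rw [hv]; positivity
  have hmem : (‖v‖⁻¹ • v) ∈ Metric.sphere (0 : Fin M → ℝ) 1 := by simp [norm_smul, hv]
  have := hmin hmem
  simp only [Set.mem_ofPred_eq, map_smul_eq_mul, norm_inv, norm_norm] at this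
  rw [inv_mul_eq_div, le_div_iff₀ hu0]
  rwa [inv_mul_eq_div, le_div_iff₀ (lt_of_le_of_ne (norm_nonneg v) (Ne.symm hv)), mul_comm] at this

theorem abs_dotProduct_le {M : ℕ} (v u : Fin M → ℝ) : |v ⬝ᵥ u| ≤ (∑ m, |v m|) * ‖u‖ := by
  rw [dotProduct, Finset.sum_mul]
  refine (Finset.abs_sum_le_sum_abs _ _).trans (Finset.sum_le_sum fun m _ => ?_)
  rw [abs_mul]
  exact mul_le_mul_of_nonneg_left (norm_le_pi_norm u m) (abs_nonneg _)

/-- Definiteness of `N` enters here: on an unbounded set `sSup` would return `0` instead of the dual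
norm. -/
theorem dualNorm_bddAbove {M : ℕ} (N : Seminorm ℝ (Fin M → ℝ)) (hN : ∀ v, N v = 0 → v = 0)
    (v : Fin M → ℝ) : BddAbove {r : ℝ | ∃ u : Fin M → ℝ, N u ≤ 1 ∧ r = v ⬝ᵥ u} := by
  obtain ⟨c, hc, h⟩ := exists_norm_le_mul N hN
  refine ⟨(∑ m, |v m|) * c, ?_⟩
  rintro _ ⟨u, hu, rfl⟩
  refine (le_abs_self _).trans ((abs_dotProduct_le v u).trans ?_)
  refine mul_le_mul_of_nonneg_left ((h u).trans ?_) (Finset.sum_nonneg fun _ _ => abs_nonneg _)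
  nlinarith

theorem dualNorm_nonneg {M : ℕ} (N : Seminorm ℝ (Fin M → ℝ)) (hN : ∀ v, N v = 0 → v = 0)
    (v : Fin M → ℝ) : 0 ≤ dualNorm N v :=
  le_csSup (dualNorm_bddAbove N hN v) ⟨0, by simp, by simp⟩

theorem dotProduct_le_dualNorm_mul {M : ℕ} (N : Seminorm ℝ (Fin M → ℝ))
    (hN : ∀ v, N v = 0 → v = 0) (v u : Fin M → ℝ) : v ⬝ᵥ u ≤ dualNorm N v * N u := by
  rcases (apply_nonneg N u).eq_or_lt with h | h
  · simp [hN u h.symm]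
  have : v ⬝ᵥ ((N u)⁻¹ • u) ≤ dualNorm N v :=
    le_csSup (dualNorm_bddAbove N hN v) ⟨_, by
      rw [map_smul_eq_mul, Real.norm_eq_abs, abs_of_pos (inv_pos.mpr h), inv_mul_cancel₀ h.ne'], rfl⟩
  rwa [dotProduct_smul, smul_eq_mul, inv_mul_eq_div, div_le_iff₀ h] at this

/-- Replaces the supremum by linear inequalities in `v`. The conjunct `0 ≤ lam` carries information
only for `M = 0`; otherwise it follows by testing `u` and `-u`. -/
theorem dualNorm_le_iff {M : ℕ} (N : Seminorm ℝ (Fin M → ℝ)) (hN : ∀ v, N v = 0 → v = 0)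
    (v : Fin M → ℝ) (lam : ℝ) :
    dualNorm N v ≤ lam ↔ 0 ≤ lam ∧ ∀ u, v ⬝ᵥ u ≤ lam * N u := by
  constructor
  · intro h
    refine ⟨(dualNorm_nonneg N hN v).trans h, fun u => ?_⟩
    exact (dotProduct_le_dualNorm_mul N hN v u).trans
      (mul_le_mul_of_nonneg_right h (apply_nonneg N u))
  · rintro ⟨h0, h⟩
    refine csSup_le ⟨_, 0, by simp, rfl⟩ ?_
    rintro _ ⟨u, hu, rfl⟩
    nlinarith [h u]

/-- Every direction is normed by a functional in the unit ball of the dual norm. -/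
theorem exists_dotProduct_eq_seminorm {M : ℕ} (N : Seminorm ℝ (Fin M → ℝ)) (z : Fin M → ℝ) :
    ∃ v : Fin M → ℝ, v ⬝ᵥ z = N z ∧ ∀ u, v ⬝ᵥ u ≤ N u := by
  by_cases hz : z = 0
  · exact ⟨0, by simp [hz], fun u => by simp⟩
  -- Hahn–Banach: extend `c • z ↦ c * N z` from the line through `z`, dominated by `N`.
  obtain ⟨φ, h1, h2⟩ := exists_extension_of_le_sublinear
    (LinearPMap.mkSpanSingleton z (N z) hz) N
    (fun c hc x => by rw [map_smul_eq_mul, Real.norm_eq_abs, abs_of_pos hc])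
    (fun x y => map_add_le_add N x y) (by
      rintro ⟨x, hx⟩
      obtain ⟨c, rfl⟩ := Submodule.mem_span_singleton.mp hx
      change LinearPMap.mkSpanSingleton' z (N z) _ ⟨c • z, hx⟩ ≤ N (c • z)
      rw [LinearPMap.mkSpanSingleton'_apply, map_smul_eq_mul, smul_eq_mul]
      exact mul_le_mul_of_nonneg_right (le_abs_self c) (apply_nonneg N z))
  have hφ : ∀ u, (fun m => φ (Pi.single m 1)) ⬝ᵥ u = φ u := fun u => by
    conv_rhs => rw [pi_eq_sum_univ' u, map_sum]
    refine Finset.sum_congr rfl fun m _ => ?_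
    rw [map_smul, smul_eq_mul, mul_comm]
  refine ⟨fun m => φ (Pi.single m 1), ?_, fun u => (hφ u).le.trans (h2 u)⟩
  rw [hφ]
  have := h1 ⟨z, Submodule.mem_span_singleton_self z⟩
  exact this.trans (LinearPMap.mkSpanSingleton_apply ℝ ℝ hz _)

/-! ### Duality for the conjugate of the transport cost -/

/-- Testing on plus and minus the unit vectors confines this dual ball around `a` to a box. It
provides the compact side of the separation below. -/
theorem isCompact_setOf_sub_dotProduct_le {M : ℕ} (N : Seminorm ℝ (Fin M → ℝ))
    (a : Fin M → ℝ) (lam : ℝ) :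
    IsCompact {v : Fin M → ℝ | ∀ u, (v - a) ⬝ᵥ u ≤ lam * N u} := by
  have hcont : ∀ u : Fin M → ℝ, Continuous fun v : Fin M → ℝ => (v - a) ⬝ᵥ u := fun u => by
    unfold dotProduct
    fun_prop
  refine IsCompact.of_isClosed_subset
    (isCompact_univ_pi fun m : Fin M => isCompact_Icc
      (a := a m - lam * N (Pi.single m 1)) (b := a m + lam * N (Pi.single m 1))) ?_ ?_
  · simp only [Set.ofPred_forall]
    exact isClosed_iInter fun u => isClosed_le (hcont u) continuous_const
  · intro v hv m _
    have h1 := hv (Pi.single m 1)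
    have h2 := hv (-Pi.single m 1)
    rw [map_neg_eq_map] at h2
    simp only [dotProduct_neg, dotProduct_single, mul_one, Pi.sub_apply] at h1 h2
    constructor <;> linarith

/-- If `⟨a, z⟩ - λ ‖z‖ ≤ r` on the polyhedron `C z ≤ d` with `0 ≤ d`, then this is certified by
multipliers `γ ≥ 0` of the constraints. -/
theorem exists_multiplier_of_conjugate_le {M R : ℕ} (N : Seminorm ℝ (Fin M → ℝ))
    (C : Matrix (Fin R) (Fin M) ℝ) (d : Fin R → ℝ) (hd : 0 ≤ d) (a : Fin M → ℝ) {lam : ℝ}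
    (hlam : 0 ≤ lam) (r : ℝ) (h : ∀ z, C *ᵥ z ≤ d → a ⬝ᵥ z - lam * N z ≤ r) :
    ∃ γ : Fin R → ℝ, 0 ≤ γ ∧ γ ⬝ᵥ d ≤ r ∧ ∀ u, (Cᵀ *ᵥ γ - a) ⬝ᵥ u ≤ lam * N u := by
  have hr : 0 ≤ r := by simpa using h 0 (by simpa using hd)
  let L : (Fin R → ℝ) →ₗ[ℝ] (Fin M → ℝ) × ℝ := (Matrix.mulVecLin Cᵀ).prod
    { toFun := fun γ => γ ⬝ᵥ d
      map_add' := fun x y => add_dotProduct x y d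
      map_smul' := fun c x => smul_dotProduct c x d }
  have hL : ∀ γ, L γ = (Cᵀ *ᵥ γ, γ ⬝ᵥ d) := fun γ => rfl
  let K : ProperCone ℝ ((Fin M → ℝ) × ℝ) :=
    { carrier := L '' {γ | 0 ≤ γ}
      add_mem' := by
        rintro _ _ ⟨x, hx, rfl⟩ ⟨y, hy, rfl⟩
        exact ⟨x + y, (add_nonneg hx hy : (0 : Fin R → ℝ) ≤ x + y), map_add L x y⟩
      zero_mem' := ⟨0, le_refl (0 : Fin R → ℝ), map_zero L⟩
      smul_mem' := by
        rintro c _ ⟨x, hx, rfl⟩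
        exact ⟨c.1 • x, (smul_nonneg c.2 hx : (0 : Fin R → ℝ) ≤ c.1 • x), map_smul L c.1 x⟩
      isClosed' := isClosed_image_nonneg L }
  -- A common point of `B` and the cone `K` is exactly the required `γ`. The lower end `0` of the
  -- interval makes `B` compact and excludes nothing, since `γ ⬝ᵥ d ≥ 0`.
  set B : Set ((Fin M → ℝ) × ℝ) :=
    {v : Fin M → ℝ | ∀ u, (v - a) ⬝ᵥ u ≤ lam * N u} ×ˢ Set.Icc 0 r with hB
  by_cases hdisj : Disjoint B K
  · exfalso
    have hconv : Convex ℝ B := by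
      refine Convex.prod ?_ (convex_Icc 0 r)
      intro x hx y hy s t hs ht hst u
      have e : s • x + t • y - a = s • (x - a) + t • (y - a) := by
        rw [smul_sub, smul_sub, sub_add_sub_comm, ← add_smul, hst, one_smul]
      rw [e, add_dotProduct, smul_dotProduct, smul_dotProduct, smul_eq_mul, smul_eq_mul]
      calc _ ≤ s * (lam * N u) + t * (lam * N u) := by gcongr <;> [exact hx u; exact hy u]
        _ = _ := by rw [← add_mul, hst, one_mul]
    obtain ⟨f, hfK, hfB⟩ := K.hyperplane_separation hconv
      ((isCompact_setOf_sub_dotProduct_le N a lam).prod isCompact_Icc) hdisj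
    set τ := f (0, 1) with hτ
    set ζ : Fin M → ℝ := fun m => - f (Pi.single m 1, 0) with hζ
    have hf : ∀ v ρ, f (v, ρ) = - (v ⬝ᵥ ζ) + ρ * τ := by
      intro v ρ
      have e1 : ((v, ρ) : (Fin M → ℝ) × ℝ) =
          ContinuousLinearMap.inl ℝ (Fin M → ℝ) ℝ v + ρ • ((0, 1) : (Fin M → ℝ) × ℝ) := by simp
      rw [e1, map_add, map_smul, smul_eq_mul, ← hτ]
      congr 1
      change (f.comp (ContinuousLinearMap.inl ℝ (Fin M → ℝ) ℝ)) v = _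
      conv_lhs => rw [pi_eq_sum_univ' v, map_sum]
      rw [dotProduct, ← Finset.sum_neg_distrib]
      refine Finset.sum_congr rfl fun m _ => ?_
      rw [map_smul, smul_eq_mul]
      simp [hζ]
    have hCζ : ∀ k, (C *ᵥ ζ) k ≤ τ * d k := by
      intro k
      have := hfK _ ⟨Pi.single k 1, (by simp : (0 : Fin R → ℝ) ≤ Pi.single k 1), rfl⟩
      rw [hL, hf, Matrix.mulVec_transpose, ← Matrix.dotProduct_mulVec, single_dotProduct,
        single_dotProduct] at this
      linarith
    obtain ⟨v₀, hv₀, hv₀'⟩ := exists_dotProduct_eq_seminorm N ζ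
    -- The worst point of the dual ball for `f` is `a - lam • v₀`, where `v₀` norms `ζ`.
    have hmem : ∀ ρ ∈ Set.Icc 0 r, ρ * τ < a ⬝ᵥ ζ - lam * N ζ := by
      intro ρ hρ
      have := hfB (a - lam • v₀, ρ) ⟨fun u => ?_, hρ⟩
      · rw [hf, sub_dotProduct, smul_dotProduct, hv₀, smul_eq_mul] at this
        linarith
      · rw [sub_sub_cancel_left, neg_dotProduct, ← dotProduct_neg, smul_dotProduct, smul_eq_mul]
        refine mul_le_mul_of_nonneg_left ((hv₀' (-u)).trans_eq ?_) hlam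
        exact map_neg_eq_map N u
    have hscale : ∀ c : ℝ, 0 ≤ c → (∀ k, c * (τ * d k) ≤ d k) →
        c * (a ⬝ᵥ ζ - lam * N ζ) ≤ r := by
      intro c hc hcd
      have := h (c • ζ) (fun k => by
        rw [Matrix.mulVec_smul, Pi.smul_apply, smul_eq_mul]
        exact (mul_le_mul_of_nonneg_left (hCζ k) hc).trans (hcd k))
      rw [dotProduct_smul, map_smul_eq_mul, Real.norm_eq_abs, abs_of_nonneg hc, smul_eq_mul] at this
      linarith
    have h0 := hmem 0 ⟨le_rfl, hr⟩
    rw [zero_mul] at h0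
    -- If `τ ≤ 0`, then `ζ` is a recession direction along which the objective grows without bound;
    -- if `τ > 0`, the feasible point `τ⁻¹ • ζ` has value above `r`. Both contradict `h`.
    rcases le_or_gt τ 0 with hτ0 | hτ0
    · have := hscale ((r + 1) / (a ⬝ᵥ ζ - lam * N ζ)) (by positivity) (fun k => by
        refine le_trans ?_ (hd k)
        exact mul_nonpos_of_nonneg_of_nonpos (by positivity)
          (mul_nonpos_of_nonpos_of_nonneg hτ0 (hd k)))
      rw [div_mul_cancel₀ _ h0.ne'] at this
      linarith
    · have h1 := hscale τ⁻¹ (by positivity) (fun k => by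
        rw [inv_mul_cancel_left₀ hτ0.ne'])
      have h2 := hmem r ⟨hr, le_rfl⟩
      rw [inv_mul_le_iff₀ hτ0] at h1
      linarith
  · obtain ⟨_, hxB, γ, hγ, rfl⟩ := Set.not_disjoint_iff.mp hdisj
    exact ⟨γ, hγ, hxB.2.2, hxB.1⟩

/-! ### Lagrange multiplier for the transport budget -/

/-- A Lagrange multiplier for a scalar budget constraint exists as soon as the value is bounded
along two-point mixtures of the decisions. -/
theorem exists_lagrange_multiplier {S : Type*} (e v : S → ℝ) {ε V : ℝ} (hε : 0 < ε) (s₀ : S)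
    (hs₀ : e s₀ = 0)
    (h : ∀ s₁ s₂, ∀ θ ∈ Set.Icc (0 : ℝ) 1, θ * e s₁ + (1 - θ) * e s₂ ≤ ε →
      θ * v s₁ + (1 - θ) * v s₂ ≤ V) :
    ∃ lam : ℝ, 0 ≤ lam ∧ ∀ s, v s - lam * e s ≤ V - lam * ε := by
  have hone : ∀ s, e s ≤ ε → v s ≤ V := fun s hs => by
    simpa using h s s 1 ⟨zero_le_one, le_rfl⟩ (by simpa using hs)
  -- `lam` is the slope of a line through `(ε, V)` lying above all points `(e s, v s)`: over-budget
  -- points bound it from below, under-budget points from above, and the inserted `0` forces `lam ≥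
  -- 0`.
  obtain ⟨lam, hl, hu⟩ := exists_between_of_forall_le
    (s := insert 0 {l | ∃ s, ε < e s ∧ l = (v s - V) / (e s - ε)})
    (t := {u | ∃ s, e s < ε ∧ u = (V - v s) / (ε - e s)})
    ⟨0, by simp⟩ ⟨_, s₀, by rw [hs₀]; exact hε, rfl⟩ (by
      rintro l hl _ ⟨s₂, hs₂, rfl⟩
      have h2 : 0 < ε - e s₂ := sub_pos.mpr hs₂
      rcases hl with rfl | ⟨s₁, hs₁, rfl⟩
      · exact div_nonneg (sub_nonneg.mpr (hone s₂ hs₂.le)) h2.le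
      · have h1 : 0 < e s₁ - ε := sub_pos.mpr hs₁
        have hd : 0 < e s₁ - e s₂ := by linarith
        have hθ : 1 - (ε - e s₂) / (e s₁ - e s₂) = (e s₁ - ε) / (e s₁ - e s₂) := by
          field_simp
          ring
        -- This `θ` makes the mixture spend exactly `ε`.
        have := h s₁ s₂ ((ε - e s₂) / (e s₁ - e s₂))
          ⟨by positivity, (div_le_one hd).mpr (by linarith)⟩ (by
            rw [hθ]
            apply le_of_eq
            field_simp
            ring)
        rw [hθ, div_mul_eq_mul_div, div_mul_eq_mul_div, ← add_div, div_le_iff₀ hd] at this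
        rw [div_le_div_iff₀ h1 h2]
        nlinarith)
  refine ⟨lam, hl (by simp), fun s => ?_⟩
  rcases lt_trichotomy (e s) ε with hs | hs | hs
  · have := hu ⟨s, hs, rfl⟩
    rw [le_div_iff₀ (sub_pos.mpr hs)] at this
    linarith
  · have := hone s hs.le
    rw [hs]
    linarith
  · have := hl (Or.inr ⟨s, hs, rfl⟩)
    rw [div_le_iff₀ (sub_pos.mpr hs)] at this
    linarith

/-- A bound on a weighted sum over all independent choices bounds the weighted sum of suprema. -/
theorem exists_sum_upperBounds_le {ι S : Type*} [Fintype ι] (w : ι → ℝ)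
    (hw : ∀ i, 0 ≤ w i) (hw1 : ∑ i, w i = 1) (f : ι → S → ℝ) (σ₀ : S) (c : ℝ)
    (h : ∀ σ : ι → S, ∑ i, w i * f i (σ i) ≤ c) :
    ∃ s : ι → ℝ, (∀ i, 0 < w i → ∀ x, f i x ≤ s i) ∧ ∑ i, w i * s i ≤ c := by
  classical
  have hbdd : ∀ i, 0 < w i → BddAbove (Set.range (f i)) := by
    intro i hi
    -- Only coordinate `i` varies; freezing the others at `σ₀` leaves this bound.
    refine ⟨(c - ∑ k ∈ Finset.univ.erase i, w k * f k σ₀) / w i, ?_⟩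
    rintro _ ⟨x, rfl⟩
    have := h (Function.update (fun _ => σ₀) i x)
    rw [← Finset.add_sum_erase _ _ (Finset.mem_univ i), Function.update_self] at this
    have e : ∑ k ∈ Finset.univ.erase i, w k * f k (Function.update (fun _ => σ₀) i x k)
        = ∑ k ∈ Finset.univ.erase i, w k * f k σ₀ :=
      Finset.sum_congr rfl fun k hk => by rw [Function.update_of_ne (Finset.ne_of_mem_erase hk)]
    rw [le_div_iff₀ hi]
    linarith
  refine ⟨fun i => ⨆ x, f i x, fun i hi x => le_ciSup (hbdd i hi) x, ?_⟩
  refine le_of_forall_pos_le_add fun δ hδ => ?_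
  -- Choices within `δ` of each supremum; as the weights sum to `1`, the total error is `δ`.
  have hσ : ∀ i, ∃ x, 0 < w i → (⨆ x, f i x) - δ ≤ f i x := by
    intro i
    have : Nonempty S := ⟨σ₀⟩
    obtain ⟨x, hx⟩ := exists_lt_of_lt_ciSup (sub_lt_self (⨆ x, f i x) hδ)
    exact ⟨x, fun _ => hx.le⟩
  choose σ hσ using hσ
  calc ∑ i, w i * ⨆ x, f i x ≤ ∑ i, (w i * f i (σ i) + w i * δ) := by
        refine Finset.sum_le_sum fun i _ => ?_
        rcases (hw i).eq_or_lt with h0 | h0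
        · simp [← h0]
        · nlinarith [hσ i h0]
    _ = ∑ i, w i * f i (σ i) + δ := by
        rw [Finset.sum_add_distrib, ← Finset.sum_mul, hw1, one_mul]
    _ ≤ c + δ := by gcongr; exact h σ

/-! ### Finitely supported measures -/

/-- The finitely supported measure `∑ i, w i δ_{p i}`. -/
noncomputable def atomic {ι α : Type*} [Fintype ι] [MeasurableSpace α] (w : ι → ℝ) (p : ι → α) : Measure α :=
  ∑ i, ENNReal.ofReal (w i) • Measure.dirac (p i)

section Atomic

variable {ι α : Type*} [Fintype ι] [MeasurableSpace α] (w : ι → ℝ) (p : ι → α)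

theorem empirical_eq_atomic {M H I : ℕ} (t : Fin H → ℝ) (ξhat : Fin H → Fin I → Fin M → ℝ) :
    empirical t ξhat =
      atomic (fun i : Fin H × Fin I => t i.1 / (I : ℝ)) (fun i => ξhat i.1 i.2) := by
  rw [empirical, atomic, Fintype.sum_prod_type]

theorem atomic_apply {s : Set α} (hs : MeasurableSet s) :
    atomic w p s = ∑ i, ENNReal.ofReal (w i) * s.indicator 1 (p i) := by
  simp [atomic, Measure.finsetSum_apply, Measure.dirac_apply' _ hs]

theorem atomic_compl_eq_zero_iff {s : Set α} (hs : MeasurableSet s) :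
    atomic w p sᶜ = 0 ↔ ∀ i, 0 < w i → p i ∈ s := by
  classical
  rw [atomic_apply w p hs.compl, Finset.sum_eq_zero_iff]
  refine forall_congr' fun i => ?_
  by_cases h : p i ∈ s <;> simp [h]

theorem map_atomic {β : Type*} [MeasurableSpace β] {f : α → β} (hf : Measurable f) :
    (atomic w p).map f = atomic w (fun i => f (p i)) := by
  ext s hs
  rw [Measure.map_apply hf hs, atomic_apply w p (hf hs), atomic_apply _ _ hs]
  rfl

theorem lintegral_atomic {f : α → ℝ≥0∞} (hf : Measurable f) :
    ∫⁻ x, f x ∂(atomic w p) = ∑ i, ENNReal.ofReal (w i) * f (p i) := by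
  simp [atomic, lintegral_finsetSum_measure, lintegral_dirac' _ hf]

variable [MeasurableSingletonClass α]

theorem integrable_atomic (f : α → ℝ) : Integrable f (atomic w p) :=
  integrable_finsetSum_measure.mpr fun i _ =>
    (integrable_dirac (by simp)).smul_measure ENNReal.ofReal_ne_top

theorem integral_atomic (hw : ∀ i, 0 ≤ w i) (f : α → ℝ) :
    ∫ x, f x ∂(atomic w p) = ∑ i, w i * f (p i) := by
  rw [atomic, integral_finsetSum_measure fun i _ =>
    (integrable_dirac (by simp)).smul_measure ENNReal.ofReal_ne_top]
  refine Finset.sum_congr rfl fun i _ => ?_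
  rw [integral_smul_measure, integral_dirac, ENNReal.toReal_ofReal (hw i), smul_eq_mul]

end Atomic

theorem restrict_eq_self_of_compl_null {α : Type*} [MeasurableSpace α] {μ : Measure α} {s : Set α}
    (h : μ sᶜ = 0) : μ.restrict s = μ :=
  Measure.restrict_eq_self_of_ae_mem (mem_ae_iff.mpr h)

/-! ### The Wasserstein ball around a finitely supported measure -/

/-- Moving the atoms of a finitely supported measure within the transport budget stays in the
ambiguity set. -/
theorem atomic_mem_ambiguitySet {ι : Type*} [Fintype ι] {M : ℕ} (N : Seminorm ℝ (Fin M → ℝ))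
    {Ξ : Set (Fin M → ℝ)} (hΞ : MeasurableSet Ξ) {ε : ℝ} (u : ι → ℝ) (hu : ∀ k, 0 ≤ u k)
    (hu1 : ∑ k, u k = 1) (q p : ι → Fin M → ℝ) (hq : ∀ k, 0 < u k → q k ∈ Ξ)
    (hp : ∀ k, 0 < u k → p k ∈ Ξ) (hcost : ∑ k, u k * N (q k - p k) ≤ ε) :
    atomic u q ∈ ambiguitySet N Ξ ε (atomic u p) := by
  have hsum : ∀ f : ι → ℝ, (∀ k, 0 ≤ f k) →
      ∑ k, ENNReal.ofReal (u k) * ENNReal.ofReal (f k) = ENNReal.ofReal (∑ k, u k * f k) := by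
    intro f hf
    rw [ENNReal.ofReal_sum_of_nonneg fun k _ => mul_nonneg (hu k) (hf k)]
    exact Finset.sum_congr rfl fun k _ => (ENNReal.ofReal_mul (hu k)).symm
  have hNm : Measurable N := (continuous_seminorm N).measurable
  have hq0 := (atomic_compl_eq_zero_iff u q hΞ).mpr hq
  refine ⟨⟨⟨?_⟩, hq0, ?_⟩, ?_⟩
  · rw [atomic_apply u q MeasurableSet.univ]
    simp [← ENNReal.ofReal_sum_of_nonneg fun k _ => hu k, hu1]
  · rw [restrict_eq_self_of_compl_null hq0, lintegral_atomic u q hNm.ennreal_ofReal,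
      hsum _ fun k => apply_nonneg N _]
    exact ENNReal.ofReal_lt_top
  · have h0 : atomic u (fun k => (q k, p k)) (Ξ ×ˢ Ξ)ᶜ = 0 :=
      (atomic_compl_eq_zero_iff u _ (hΞ.prod hΞ)).mpr fun k hk => ⟨hq k hk, hp k hk⟩
    -- The coupling transports the mass `u k` from `p k` to `q k`.
    refine (iInf₂_le (atomic u fun k => (q k, p k))
      ⟨h0, map_atomic u _ measurable_fst, map_atomic u _ measurable_snd⟩).trans ?_
    have hm : Measurable fun z : (Fin M → ℝ) × (Fin M → ℝ) => ENNReal.ofReal (N (z.1 - z.2)) :=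
      (hNm.comp (measurable_fst.sub measurable_snd)).ennreal_ofReal
    rw [restrict_eq_self_of_compl_null h0, lintegral_atomic u _ hm,
      hsum _ fun k => apply_nonneg N _]
    exact ENNReal.ofReal_le_ofReal hcost

/-- Weak duality: a majorant of `F` of the form `λ ‖ξ - ζ‖ + S ζ` bounds the expectation of `F`
over the whole Wasserstein ball. -/
theorem integral_le_of_mem_ambiguitySet {M : ℕ} (N : Seminorm ℝ (Fin M → ℝ))
    {Ξ : Set (Fin M → ℝ)} {ε : ℝ} (hε : 0 ≤ ε) {P Q : Measure (Fin M → ℝ)}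
    (hQ : Q ∈ ambiguitySet N Ξ ε P) {F S : (Fin M → ℝ) → ℝ} (hF : Continuous F)
    (hS : Continuous S) (hSP : Integrable S P) {c₁ c₂ : ℝ} (hgrowth : ∀ ξ, |F ξ| ≤ c₁ * N ξ + c₂)
    {lam : ℝ} (hlam : 0 ≤ lam) (h : ∀ ξ ∈ Ξ, ∀ ζ, F ξ ≤ lam * N (ξ - ζ) + S ζ) :
    ∫ ξ in Ξ, F ξ ∂Q ≤ lam * ε + ∫ ζ, S ζ ∂P := by
  obtain ⟨⟨hprob, hQ0, hmom⟩, hW⟩ := hQ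
  have hNc := continuous_seminorm N
  rw [restrict_eq_self_of_compl_null hQ0] at hmom ⊢
  have hNQ : Integrable (fun ξ => N ξ) Q :=
    ⟨hNc.aestronglyMeasurable, (hasFiniteIntegral_iff_ofReal
      (Filter.Eventually.of_forall fun ξ => apply_nonneg N ξ)).mpr hmom⟩
  have hFQ : Integrable F Q :=
    ((hNQ.const_mul c₁).add (integrable_const c₂)).mono' hF.aestronglyMeasurable
      (Filter.Eventually.of_forall hgrowth)
  -- No optimal coupling is assumed to exist, so one of cost below `ε + δ` is used and `δ` tends to
  -- `0`.
  suffices hδ : ∀ δ > 0, ∫ ξ, F ξ ∂Q ≤ lam * (ε + δ) + ∫ ζ, S ζ ∂P by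
    have hlim : Filter.Tendsto (fun δ : ℝ => lam * (ε + δ) + ∫ ζ, S ζ ∂P)
        (nhdsWithin 0 (Set.Ioi 0)) (nhds (lam * (ε + 0) + ∫ ζ, S ζ ∂P)) :=
      ((by fun_prop : Continuous fun δ : ℝ => lam * (ε + δ) + ∫ ζ, S ζ ∂P).tendsto 0).mono_left
        nhdsWithin_le_nhds
    rw [add_zero] at hlim
    exact ge_of_tendsto hlim (Filter.eventually_of_mem self_mem_nhdsWithin hδ)
  intro δ hδ
  have hlt : wasserstein N Ξ P Q < ENNReal.ofReal (ε + δ) :=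
    hW.trans_lt ((ENNReal.ofReal_lt_ofReal_iff (by linarith)).mpr (by linarith))
  obtain ⟨π, ⟨hπ0, hfst, hsnd⟩, hcost⟩ := by simpa only [wasserstein, iInf_lt_iff] using hlt
  rw [restrict_eq_self_of_compl_null hπ0] at hcost
  have hNc' : Continuous fun z : (Fin M → ℝ) × (Fin M → ℝ) => N (z.1 - z.2) :=
    hNc.comp (continuous_fst.sub continuous_snd)
  have hN0 : 0 ≤ᵐ[π] fun z => N (z.1 - z.2) := Filter.Eventually.of_forall fun z => apply_nonneg N _
  have hNπ : Integrable (fun z => N (z.1 - z.2)) π :=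
    ⟨hNc'.aestronglyMeasurable,
      (hasFiniteIntegral_iff_ofReal hN0).mpr (hcost.trans ENNReal.ofReal_lt_top)⟩
  have hNle : ∫ z, N (z.1 - z.2) ∂π ≤ ε + δ := by
    rw [integral_eq_lintegral_of_nonneg_ae hN0 hNc'.aestronglyMeasurable]
    exact ENNReal.toReal_le_of_le_ofReal (by linarith) hcost.le
  have hFπ : Integrable (fun z => F z.1) π :=
    (integrable_map_measure hF.aestronglyMeasurable measurable_fst.aemeasurable).mp (hfst ▸ hFQ)
  have hSπ : Integrable (fun z => S z.2) π :=
    (integrable_map_measure hS.aestronglyMeasurable measurable_snd.aemeasurable).mp (hsnd ▸ hSP)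
  calc ∫ ξ, F ξ ∂Q = ∫ z, F z.1 ∂π := by
        rw [← hfst, integral_map measurable_fst.aemeasurable hF.aestronglyMeasurable]
    _ ≤ ∫ z, (lam * N (z.1 - z.2) + S z.2) ∂π := by
        refine integral_mono_ae hFπ ((hNπ.const_mul lam).add hSπ) ?_
        filter_upwards [mem_ae_iff.mpr hπ0] with z hz
        exact h z.1 hz.1 z.2
    _ = lam * ∫ z, N (z.1 - z.2) ∂π + ∫ z, S z.2 ∂π := by
        rw [integral_add (hNπ.const_mul lam) hSπ, integral_const_mul]
    _ ≤ lam * (ε + δ) + ∫ ζ, S ζ ∂P := by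
        have : ∫ z, S z.2 ∂π = ∫ ζ, S ζ ∂P := by
          rw [← hsnd, integral_map measurable_snd.aemeasurable hS.aestronglyMeasurable]
        rw [this]
        gcongr

/-! ### Strong duality for a fixed decision -/

theorem continuous_dotProduct_right {M : ℕ} (v : Fin M → ℝ) :
    Continuous fun u : Fin M → ℝ => v ⬝ᵥ u := by
  unfold dotProduct
  fun_prop

theorem isClosed_uncertaintySet {M R : ℕ} (C : Matrix (Fin R) (Fin M) ℝ) (g : Fin R → ℝ) :
    IsClosed (uncertaintySet C g) :=
  isClosed_le (C.mulVecLin.continuous_of_finiteDimensional) continuous_const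

section FixedDecision

variable {K M J R : ℕ} [NeZero J] {ι : Type*} [Fintype ι]
  (N : Seminorm ℝ (Fin M → ℝ))
  (a : Fin J → (Fin K → ℝ) →ᵃ[ℝ] (Fin M → ℝ)) (b : Fin J → (Fin K → ℝ) →ᵃ[ℝ] ℝ)
  (x : Fin K → ℝ) (C : Matrix (Fin R) (Fin M) ℝ) (g : Fin R → ℝ)

theorem continuous_loss : Continuous (loss a b x) := by
  unfold loss
  exact Continuous.finset_sup'_apply _ fun j _ =>
    (continuous_dotProduct_right (a j x)).add continuous_const

theorem le_loss (j : Fin J) (ξ : Fin M → ℝ) : a j x ⬝ᵥ ξ + b j x ≤ loss a b x ξ :=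
  Finset.le_sup' (fun j => a j x ⬝ᵥ ξ + b j x) (Finset.mem_univ j)

/-- Linear growth makes the loss integrable under every measure with finite first moment. -/
theorem abs_loss_le (hN : ∀ v, N v = 0 → v = 0) (ξ : Fin M → ℝ) :
    |loss a b x ξ| ≤ (∑ j, dualNorm N (a j x)) * N ξ + ∑ j, |b j x| := by
  obtain ⟨j, -, hj⟩ := Finset.exists_mem_eq_sup' Finset.univ_nonempty
    fun j => a j x ⬝ᵥ ξ + b j x
  rw [loss, hj]
  refine (abs_add_le _ _).trans (add_le_add ?_ ?_)
  · have h1 := dotProduct_le_dualNorm_mul N hN (a j x) ξ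
    have h2 := dotProduct_le_dualNorm_mul N hN (a j x) (-ξ)
    rw [dotProduct_neg, map_neg_eq_map] at h2
    refine (abs_le.mpr ⟨by linarith, h1⟩).trans ?_
    exact mul_le_mul_of_nonneg_right (Finset.single_le_sum (f := fun j => dualNorm N (a j x))
      (fun j _ => dualNorm_nonneg N hN _) (Finset.mem_univ j)) (apply_nonneg N ξ)
  · exact Finset.single_le_sum (f := fun j => |b j x|) (fun j _ => abs_nonneg _)
      (Finset.mem_univ j)

/-- Weak duality for the finite program. -/
theorem integral_loss_le_of_feasible [Nonempty ι] (hN : ∀ v, N v = 0 → v = 0) {ε : ℝ} (hε : 0 ≤ ε) (w : ι → ℝ)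
    (hw : ∀ i, 0 ≤ w i) (p : ι → Fin M → ℝ) {lam : ℝ} {s : ι → ℝ} {γ : ι → Fin J → Fin R → ℝ}
    (h : ∀ i j, b j x + a j x ⬝ᵥ p i + γ i j ⬝ᵥ (g - C *ᵥ p i) ≤ s i ∧
      dualNorm N (Cᵀ *ᵥ γ i j - a j x) ≤ lam ∧ 0 ≤ γ i j)
    {Q : Measure (Fin M → ℝ)} (hQ : Q ∈ ambiguitySet N (uncertaintySet C g) ε (atomic w p)) :
    ∫ ξ in uncertaintySet C g, loss a b x ξ ∂Q ≤ lam * ε + ∑ i, w i * s i := by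
  let m : Fin J → ι → (Fin M → ℝ) → ℝ := fun j i ζ =>
    b j x + a j x ⬝ᵥ ζ + γ i j ⬝ᵥ (g - C *ᵥ ζ)
  -- Every `m j i` with any transport term `λ‖ξ - ζ‖` majorizes the `j`-th piece on `Ξ`, for all
  -- `ζ`, so the minimum over `i` does too. The minimum also gives `S (p i) ≤ s i` at every atom,
  -- even if atoms coincide, and no disintegration of the coupling is needed.
  let S : (Fin M → ℝ) → ℝ := fun ζ =>
    Finset.univ.sup' Finset.univ_nonempty fun j =>
      Finset.univ.inf' Finset.univ_nonempty fun i => m j i ζ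
  have hm : ∀ j i, Continuous (m j i) := fun j i =>
    (continuous_const.add (continuous_dotProduct_right _)).add
      ((continuous_dotProduct_right _).comp
        (continuous_const.sub C.mulVecLin.continuous_of_finiteDimensional))
  have hS : Continuous S := Continuous.finset_sup'_apply _ fun j _ =>
    Continuous.finset_inf'_apply _ fun i _ => hm j i
  have hlam : 0 ≤ lam :=
    (dualNorm_nonneg N hN _).trans (h (Classical.arbitrary ι) (Classical.arbitrary _)).2.1
  refine (integral_le_of_mem_ambiguitySet N hε hQ (continuous_loss a b x) hS
    (integrable_atomic w p S) (abs_loss_le N a b x hN) hlam ?_).trans ?_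
  · intro ξ hξ ζ
    refine Finset.sup'_le _ _ fun j _ => ?_
    obtain ⟨i, -, hi⟩ := Finset.exists_mem_eq_inf' Finset.univ_nonempty fun i => m j i ζ
    have hSj : m j i ζ ≤ S ζ := hi ▸ Finset.le_sup'
      (fun j => Finset.univ.inf' Finset.univ_nonempty fun i => m j i ζ) (Finset.mem_univ j)
    refine le_trans ?_ (add_le_add_right hSj _)
    have h1 := ((dualNorm_le_iff N hN _ _).mp (h i j).2.1).2 (ζ - ξ)
    rw [map_sub_rev] at h1
    have h2 : γ i j ⬝ᵥ (C *ᵥ ξ) ≤ γ i j ⬝ᵥ g :=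
      dotProduct_le_dotProduct_of_nonneg_left hξ (h i j).2.2
    have h3 : ∀ u, (Cᵀ *ᵥ γ i j) ⬝ᵥ u = γ i j ⬝ᵥ (C *ᵥ u) := fun u => by
      rw [Matrix.mulVec_transpose, ← Matrix.dotProduct_mulVec]
    simp only [sub_dotProduct, dotProduct_sub, h3] at h1
    simp only [m, dotProduct_sub]
    linarith
  · rw [integral_atomic w p hw]
    gcongr with i
    · exact hw i
    · exact Finset.sup'_le _ _ fun j _ =>
        (Finset.inf'_le _ (Finset.mem_univ i)).trans (h i j).1

/-- Strong duality and dual attainment for the finite program. -/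
theorem exists_feasible_objective_le (hN : ∀ v, N v = 0 → v = 0) {ε : ℝ} (hε : 0 ≤ ε) (w : ι → ℝ)
    (hw : ∀ i, 0 ≤ w i) (hw1 : ∑ i, w i = 1) (p : ι → Fin M → ℝ)
    (hp : ∀ i, 0 < w i → p i ∈ uncertaintySet C g) {V : ℝ}
    (hV : ∀ Q ∈ ambiguitySet N (uncertaintySet C g) ε (atomic w p),
      ∫ ξ in uncertaintySet C g, loss a b x ξ ∂Q ≤ V) :
    ∃ (lam : ℝ) (s : ι → ℝ) (γ : ι → Fin J → Fin R → ℝ),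
      (∀ i j, b j x + a j x ⬝ᵥ p i + γ i j ⬝ᵥ (g - C *ᵥ p i) ≤ s i ∧
        dualNorm N (Cᵀ *ᵥ γ i j - a j x) ≤ lam ∧ 0 ≤ γ i j) ∧
      lam * ε + ∑ i, w i * s i ≤ V := by
  classical
  set Ξ := uncertaintySet C g with hΞdef
  have hΞ : MeasurableSet Ξ := (isClosed_uncertaintySet C g).measurableSet
  obtain ⟨i₀, hi₀⟩ : ∃ i, 0 < w i := by
    by_contra! hcon
    have := Finset.sum_nonpos fun i (_ : i ∈ Finset.univ) => hcon i
    linarith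
  -- The index type is free, so atoms may be split before being moved, provided the unmoved measure
  -- is still the reference.
  have hbound : ∀ {κ : Type _} [Fintype κ] (u : κ → ℝ) (_ : ∀ k, 0 ≤ u k) (_ : ∑ k, u k = 1)
      (q r : κ → Fin M → ℝ) (_ : ∀ k, 0 < u k → q k ∈ Ξ) (_ : ∀ k, 0 < u k → r k ∈ Ξ)
      (_ : ∑ k, u k * N (q k - r k) ≤ ε) (_ : atomic u r = atomic w p),
      ∑ k, u k * loss a b x (q k) ≤ V := by
    intro κ _ u hu hu1 q r hq hr hcost hur
    have := hV _ (hur ▸ atomic_mem_ambiguitySet N hΞ u hu hu1 q r hq hr hcost)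
    rwa [restrict_eq_self_of_compl_null ((atomic_compl_eq_zero_iff u q hΞ).mpr hq),
      integral_atomic u q hu] at this
  -- The multiplier lemma needs slack in the budget. At `ε = 0` the objective ignores `λ`, so `γ =
  -- 0` with a large `λ` works.
  rcases hε.eq_or_lt with rfl | hεpos
  · refine ⟨∑ j, dualNorm N (- a j x), fun i => loss a b x (p i), fun _ _ => 0,
      fun i j => ⟨?_, ?_, le_rfl⟩, ?_⟩
    · rw [zero_dotProduct, add_zero, add_comm]
      exact le_loss a b x j (p i)
    · rw [Matrix.mulVec_zero, zero_sub]
      exact Finset.single_le_sum (f := fun j => dualNorm N (- a j x))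
        (fun j _ => dualNorm_nonneg N hN _) (Finset.mem_univ j)
    · rw [mul_zero, zero_add]
      exact hbound w hw hw1 p p hp hp (by simp) rfl
  let ξ₀ : Ξ := ⟨p i₀, hp i₀ hi₀⟩
  -- The zero-cost plan; weightless atoms may lie outside `Ξ` and are sent to `ξ₀`.
  let σ₀ : ι → Ξ := fun i => if h : 0 < w i then ⟨p i, hp i h⟩ else ξ₀
  obtain ⟨lam, hlam, hL⟩ := exists_lagrange_multiplier
    (fun σ : ι → Ξ => ∑ i, w i * N ((σ i : Fin M → ℝ) - p i))
    (fun σ : ι → Ξ => ∑ i, w i * loss a b x (σ i)) (V := V) hεpos σ₀ (by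
      refine Finset.sum_eq_zero fun i _ => ?_
      rcases (hw i).eq_or_lt with h | h
      · simp [← h]
      · simp [σ₀, h]) (by
      rintro σ₁ σ₂ θ ⟨hθ0, hθ1⟩ hcost
      have hθ1' : 0 ≤ 1 - θ := sub_nonneg.mpr hθ1
      have hsplit : ∀ F₁ F₂ : ι → ℝ,
          θ * ∑ i, w i * F₁ i + (1 - θ) * ∑ i, w i * F₂ i =
            ∑ i, θ * w i * F₁ i + ∑ i, (1 - θ) * w i * F₂ i := by
        intro F₁ F₂
        simp only [Finset.mul_sum, mul_assoc]
      have hpos : ∀ {c : ℝ} {i}, 0 ≤ c → 0 < c * w i → 0 < w i := fun hc h =>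
        pos_of_mul_pos_right h hc
      -- A mixture of two plans splits each atom into masses `θ * w i` and `(1 - θ) * w i`, one for
      -- each plan.
      have := hbound (κ := ι ⊕ ι) (Sum.elim (fun i => θ * w i) fun i => (1 - θ) * w i)
        (by rintro (i | i) <;> exact mul_nonneg (by assumption) (hw i))
        (by simp [← Finset.mul_sum, hw1])
        (Sum.elim (fun i => (σ₁ i : Fin M → ℝ)) fun i => σ₂ i) (Sum.elim p p)
        (by rintro (i | i) _ <;> exact Subtype.coe_prop _)
        (by
          rintro (i | i) h
          · exact hp i (hpos hθ0 h)
          · exact hp i (hpos hθ1' h))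
        (by simpa [Fintype.sum_sum_type, hsplit] using hcost)
        (by
          simp only [atomic, Fintype.sum_sum_type, Sum.elim_inl, Sum.elim_inr]
          rw [← Finset.sum_add_distrib]
          refine Finset.sum_congr rfl fun i _ => ?_
          rw [← add_smul, ← ENNReal.ofReal_add (mul_nonneg hθ0 (hw i)) (mul_nonneg hθ1' (hw i))]
          congr 2
          ring)
      simpa [Fintype.sum_sum_type, hsplit] using this)
  obtain ⟨s, hs, hsum⟩ := exists_sum_upperBounds_le w hw hw1
    (fun i (ξ : Ξ) => loss a b x ξ - lam * N ((ξ : Fin M → ℝ) - p i)) ξ₀ (V - lam * ε) (by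
      intro σ
      refine le_trans (le_of_eq ?_) (hL σ)
      rw [Finset.mul_sum, ← Finset.sum_sub_distrib]
      exact Finset.sum_congr rfl fun i _ => by ring)
  have hγ : ∀ i j, ∃ γ : Fin R → ℝ, 0 < w i → 0 ≤ γ ∧
      γ ⬝ᵥ (g - C *ᵥ p i) ≤ s i - b j x - a j x ⬝ᵥ p i ∧
      ∀ u, (Cᵀ *ᵥ γ - a j x) ⬝ᵥ u ≤ lam * N u := by
    intro i j
    by_cases hi : 0 < w i
    · obtain ⟨γ, h⟩ := exists_multiplier_of_conjugate_le N C (g - C *ᵥ p i)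
        (sub_nonneg.mpr (hp i hi)) (a j x) hlam (s i - b j x - a j x ⬝ᵥ p i) (by
          intro z hz
          have hmem : p i + z ∈ Ξ := by
            change C *ᵥ (p i + z) ≤ g
            rw [Matrix.mulVec_add, add_comm]
            exact le_sub_iff_add_le.mp hz
          have h1 := hs i hi ⟨p i + z, hmem⟩
          have h2 := le_loss a b x j (p i + z)
          simp only [add_sub_cancel_left] at h1
          rw [dotProduct_add] at h2
          linarith)
      exact ⟨γ, fun _ => h⟩
    · exact ⟨0, fun h => absurd h hi⟩
  choose γ hγ using hγ
  -- Weightless atoms must still satisfy the constraints. The dual norm constraint does not depend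
  -- on the atom, so the multipliers of `i₀` are reused; `s i` can then be as large as needed at no
  -- cost.
  let γ' : ι → Fin J → Fin R → ℝ := fun i => if 0 < w i then γ i else γ i₀
  have hγ' : ∀ i j, dualNorm N (Cᵀ *ᵥ γ' i j - a j x) ≤ lam ∧ 0 ≤ γ' i j := by
    intro i j
    rw [dualNorm_le_iff N hN]
    by_cases hi : 0 < w i
    · simp only [γ', if_pos hi]
      exact ⟨⟨hlam, (hγ i j hi).2.2⟩, (hγ i j hi).1⟩
    · simp only [γ', if_neg hi]
      exact ⟨⟨hlam, (hγ i₀ j hi₀).2.2⟩, (hγ i₀ j hi₀).1⟩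
  refine ⟨lam, fun i => if 0 < w i then s i else Finset.univ.sup' Finset.univ_nonempty fun j =>
    b j x + a j x ⬝ᵥ p i + γ' i j ⬝ᵥ (g - C *ᵥ p i), γ', fun i j => ⟨?_, hγ' i j⟩, ?_⟩
  · by_cases hi : 0 < w i
    · simp only [γ', if_pos hi]
      linarith [(hγ i j hi).2.1]
    · simp only [if_neg hi]
      exact Finset.le_sup' (fun j => b j x + a j x ⬝ᵥ p i + γ' i j ⬝ᵥ (g - C *ᵥ p i))
        (Finset.mem_univ j)
  · have : ∀ i, w i * (if 0 < w i then s i else Finset.univ.sup' Finset.univ_nonempty fun j =>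
        b j x + a j x ⬝ᵥ p i + γ' i j ⬝ᵥ (g - C *ᵥ p i)) = w i * s i := by
      intro i
      rcases (hw i).eq_or_lt with h | h
      · simp [← h]
      · rw [if_pos h]
    simp only [this]
    linarith

end FixedDecision

/-! ### The finite program -/

section Program

variable {K M H I J R : ℕ} [NeZero J]
  (N : Seminorm ℝ (Fin M → ℝ)) (X : Set (Fin K → ℝ))
  (a : Fin J → (Fin K → ℝ) →ᵃ[ℝ] (Fin M → ℝ)) (b : Fin J → (Fin K → ℝ) →ᵃ[ℝ] ℝ)
  (C : Matrix (Fin R) (Fin M) ℝ) (g : Fin R → ℝ) (ξhat : Fin H → Fin I → Fin M → ℝ)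
  (t : Fin H → ℝ)

theorem worstCase_le_objective [NeZero I] (hN : ∀ v, N v = 0 → v = 0) (ht0 : ∀ h, 0 ≤ t h)
    (ht1 : ∑ h, t h = 1) {ε : ℝ} (hε : 0 ≤ ε) {x : Fin K → ℝ} {w : AuxVar H I J R}
    (hw : (x, w) ∈ feasible N X a b C g ξhat) :
    worstCase N (uncertaintySet C g) ε (empirical t ξhat) (loss a b x) ≤
      ((objective t ε (x, w) : ℝ) : EReal) := by
  obtain ⟨lam, s, γ⟩ := w
  have hH : Nonempty (Fin H) := by
    by_contra hcon
    have := not_nonempty_iff.mp hcon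
    simp at ht1
  refine iSup₂_le fun Q hQ => EReal.coe_le_coe_iff.mpr ?_
  rw [empirical_eq_atomic] at hQ
  have := integral_loss_le_of_feasible (ι := Fin H × Fin I) N a b x C g hN hε _
    (fun i => div_nonneg (ht0 i.1) (Nat.cast_nonneg I)) _ (lam := lam) (s := fun i => s i.1 i.2)
    (γ := fun i j => γ i.1 i.2 j) (fun i j => hw.2 i.1 i.2 j) hQ
  rwa [Fintype.sum_prod_type] at this

/-- Together with weak duality, this keeps the worst case below `⊤`. -/
theorem exists_feasible (hN : ∀ v, N v = 0 → v = 0) {x : Fin K → ℝ} (hx : x ∈ X) :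
    ∃ w : AuxVar H I J R, (x, w) ∈ feasible N X a b C g ξhat := by
  refine ⟨(∑ j, dualNorm N (- a j x), fun h i => loss a b x (ξhat h i), 0), hx,
    fun h i j => ⟨?_, ?_, le_rfl⟩⟩
  · rw [Pi.zero_apply, Pi.zero_apply, Pi.zero_apply, zero_dotProduct, add_zero, add_comm]
    exact le_loss a b x j (ξhat h i)
  · rw [Pi.zero_apply, Pi.zero_apply, Pi.zero_apply, Matrix.mulVec_zero, zero_sub]
    exact Finset.single_le_sum (f := fun j => dualNorm N (- a j x))
      (fun j _ => dualNorm_nonneg N hN _) (Finset.mem_univ j)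

theorem exists_objective_le_worstCase [NeZero I] (hN : ∀ v, N v = 0 → v = 0) (ht0 : ∀ h, 0 ≤ t h)
    (ht1 : ∑ h, t h = 1) (hP : empirical t ξhat (uncertaintySet C g)ᶜ = 0)
    {ε : ℝ} (hε : 0 ≤ ε) {x : Fin K → ℝ} (hx : x ∈ X) :
    ∃ w : AuxVar H I J R, (x, w) ∈ feasible N X a b C g ξhat ∧
      ((objective t ε (x, w) : ℝ) : EReal) ≤
        worstCase N (uncertaintySet C g) ε (empirical t ξhat) (loss a b x) := by
  obtain ⟨w₀, hw₀⟩ := exists_feasible N X a b C g ξhat hN hx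
  have htop := ((worstCase_le_objective N X a b C g ξhat t hN ht0 ht1 hε hw₀).trans_lt
    (EReal.coe_lt_top _)).ne
  have hΞ := (isClosed_uncertaintySet C g).measurableSet
  have hle : ∀ Q ∈ ambiguitySet N (uncertaintySet C g) ε (empirical t ξhat),
      ((∫ ξ in uncertaintySet C g, loss a b x ξ ∂Q : ℝ) : EReal) ≤
        worstCase N (uncertaintySet C g) ε (empirical t ξhat) (loss a b x) := fun Q hQ =>
    le_iSup₂ (f := fun Q (_ : Q ∈ ambiguitySet N (uncertaintySet C g) ε (empirical t ξhat)) =>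
      ((∫ ξ in uncertaintySet C g, loss a b x ξ ∂Q : ℝ) : EReal)) Q hQ
  rw [empirical_eq_atomic] at hP hle htop ⊢
  have hw : ∀ i : Fin H × Fin I, 0 ≤ t i.1 / (I : ℝ) := fun i =>
    div_nonneg (ht0 i.1) (Nat.cast_nonneg I)
  have hw1 : ∑ i : Fin H × Fin I, t i.1 / (I : ℝ) = 1 := by
    rw [Fintype.sum_prod_type]
    simp [mul_div_cancel₀, NeZero.ne, ht1]
  have hp := (atomic_compl_eq_zero_iff _ _ hΞ).mp hP
  -- The reference measure itself lies in the ball, so the worst case is not `⊥` and can serve as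
  -- the real bound `V`.
  have hbot := ((EReal.bot_lt_coe _).trans_le (hle _ (atomic_mem_ambiguitySet N hΞ _ hw hw1 _ _
    hp hp (by simpa using hε)))).ne'
  rw [← EReal.coe_toReal htop hbot] at hle ⊢
  obtain ⟨lam, s, γ, hfeas, hobj⟩ := exists_feasible_objective_le N a b x C g hN hε _ hw hw1 _ hp
    (fun Q hQ => EReal.coe_le_coe_iff.mp (hle Q hQ))
  refine ⟨(lam, fun h i => s (h, i), fun h i j => γ (h, i) j),
    ⟨hx, fun h i j => hfeas (h, i) j⟩, EReal.coe_le_coe_iff.mpr ?_⟩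
  rwa [Fintype.sum_prod_type] at hobj

end Program

/-! ### The linear case -/

/-- Unit vectors have `ℓ₁` norm one, giving one direction; Hölder's inequality gives the other. -/
theorem dualNorm_le_iff_of_l1 {M : ℕ} (N : Seminorm ℝ (Fin M → ℝ))
    (h1 : ∀ v, N v = ∑ m, |v m|) (v : Fin M → ℝ) (lam : ℝ) :
    dualNorm N v ≤ lam ↔ 0 ≤ lam ∧ ∀ m, |v m| ≤ lam := by
  have hN : ∀ v, N v = 0 → v = 0 := by
    intro v hv
    rw [h1, Finset.sum_eq_zero_iff_of_nonneg fun _ _ => abs_nonneg _] at hv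
    exact funext fun m => abs_eq_zero.mp (hv m (Finset.mem_univ m))
  rw [dualNorm_le_iff N hN]
  refine and_congr_right fun h0 => ⟨fun h m => ?_, fun h u => ?_⟩
  · have e : N (Pi.single m 1) = 1 := by
      rw [h1, Finset.sum_eq_single m (fun k _ hk => by simp [Pi.single_eq_of_ne hk]) (by simp)]
      simp
    have h2 := h (Pi.single m 1)
    have h3 := h (-Pi.single m 1)
    rw [map_neg_eq_map] at h3
    simp only [dotProduct_neg, dotProduct_single, mul_one, e] at h2 h3
    exact abs_le.mpr ⟨by linarith, h2⟩
  · rw [h1, dotProduct, Finset.mul_sum]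
    refine Finset.sum_le_sum fun m _ => (le_abs_self _).trans ?_
    rw [abs_mul]
    exact mul_le_mul_of_nonneg_right (h m) (abs_nonneg _)

theorem dualNorm_eq_iSup_abs_of_l1 {M : ℕ} (N : Seminorm ℝ (Fin M → ℝ))
    (h1 : ∀ v, N v = ∑ m, |v m|) (v : Fin M → ℝ) : dualNorm N v = ⨆ m, |v m| := by
  obtain ⟨h0, h⟩ := (dualNorm_le_iff_of_l1 N h1 v _).mp le_rfl
  refine le_antisymm ((dualNorm_le_iff_of_l1 N h1 v _).mpr
    ⟨Real.iSup_nonneg fun m => abs_nonneg _, fun m => ?_⟩) (Real.iSup_le h h0)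
  exact le_ciSup (f := fun m => |v m|) (Set.finite_range _).bddAbove m

section Polyhedral

variable {V : Type*} [AddCommGroup V] [Module ℝ V]

theorem isPolyhedral_of_fintype {κ : Type*} [Fintype κ] (f : κ → V →ₗ[ℝ] ℝ) (c : κ → ℝ) :
    IsPolyhedral {v | ∀ k, f k v ≤ c k} := by
  refine ⟨Fintype.card κ, fun k => f ((Fintype.equivFin κ).symm k),
    fun k => c ((Fintype.equivFin κ).symm k), ?_⟩
  ext v
  exact ⟨fun h k => h _, fun h k => by simpa using h (Fintype.equivFin κ k)⟩

theorem IsPolyhedral.iInter {κ : Type*} [Fintype κ] {S : κ → Set V}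
    (h : ∀ k, IsPolyhedral (S k)) : IsPolyhedral (⋂ k, S k) := by
  choose n f c h using h
  convert isPolyhedral_of_fintype (κ := Σ k, Fin (n k)) (fun k => f k.1 k.2) (fun k => c k.1 k.2)
  ext v
  simp [h, Sigma.forall]

theorem IsPolyhedral.inter {S T : Set V} (hS : IsPolyhedral S) (hT : IsPolyhedral T) :
    IsPolyhedral (S ∩ T) := by
  rw [Set.inter_eq_iInter]
  exact IsPolyhedral.iInter fun k => by cases k <;> assumption

theorem IsPolyhedral.preimage {W : Type*} [AddCommGroup W] [Module ℝ W] {S : Set W}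
    (hS : IsPolyhedral S) (L : V →ₗ[ℝ] W) : IsPolyhedral (L ⁻¹' S) := by
  obtain ⟨n, f, c, rfl⟩ := hS
  exact ⟨n, fun k => (f k).comp L, c, rfl⟩

theorem isPolyhedral_setOf_affine_le (φ ψ : V →ᵃ[ℝ] ℝ) : IsPolyhedral {v | φ v ≤ ψ v} := by
  refine ⟨1, fun _ => φ.linear - ψ.linear, fun _ => ψ 0 - φ 0, ?_⟩
  ext v
  have h1 := congrFun φ.decomp v
  have h2 := congrFun ψ.decomp v
  simp only [Pi.add_apply] at h1 h2
  simp only [Set.mem_ofPred_eq, LinearMap.sub_apply, forall_const, h1, h2]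
  constructor <;> intro h <;> linarith

end Polyhedral

/-- The objective of the finite program as a linear functional. -/
noncomputable def objectiveLinear {K H I J R : ℕ} (t : Fin H → ℝ) (ε : ℝ) :
    (Fin K → ℝ) × AuxVar H I J R →ₗ[ℝ] ℝ where
  toFun := objective t ε
  map_add' := fun v w => by
    simp only [objective, Pi.add_apply, mul_add, add_mul,
      Finset.sum_add_distrib]
    ring
  map_smul' := fun c v => by
    simp only [objective, Prod.smul_fst, Prod.smul_snd, Pi.smul_apply, smul_eq_mul,
      RingHom.id_apply, mul_add, Finset.mul_sum, mul_left_comm, mul_assoc]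

/-- For the `ℓ₁` norm, the dual norm constraint is `0 ≤ λ` together with two affine inequalities per
coordinate; all other constraints are already affine. -/
theorem isPolyhedral_feasible {K M H I J R : ℕ} (N : Seminorm ℝ (Fin M → ℝ))
    (h1 : ∀ v, N v = ∑ m, |v m|) {X : Set (Fin K → ℝ)} (hX : IsPolyhedral X)
    (a : Fin J → (Fin K → ℝ) →ᵃ[ℝ] (Fin M → ℝ)) (b : Fin J → (Fin K → ℝ) →ᵃ[ℝ] ℝ)
    (C : Matrix (Fin R) (Fin M) ℝ) (g : Fin R → ℝ) (ξhat : Fin H → Fin I → Fin M → ℝ) :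
    IsPolyhedral (feasible N X a b C g ξhat) := by
  let U := (Fin K → ℝ) × AuxVar H I J R
  let X' : U →ₗ[ℝ] (Fin K → ℝ) := LinearMap.fst ℝ _ _
  let lam' : U →ₗ[ℝ] ℝ := LinearMap.fst ℝ _ _ ∘ₗ LinearMap.snd ℝ _ _
  let s' : Fin H → Fin I → U →ₗ[ℝ] ℝ := fun h i =>
    LinearMap.proj i ∘ₗ LinearMap.proj h ∘ₗ LinearMap.fst ℝ _ _ ∘ₗ LinearMap.snd ℝ _ _ ∘ₗ
      LinearMap.snd ℝ _ _
  let γ' : Fin H → Fin I → Fin J → U →ₗ[ℝ] (Fin R → ℝ) := fun h i j =>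
    LinearMap.proj j ∘ₗ LinearMap.proj i ∘ₗ LinearMap.proj h ∘ₗ LinearMap.snd ℝ _ _ ∘ₗ
      LinearMap.snd ℝ _ _ ∘ₗ LinearMap.snd ℝ _ _
  let dot : ∀ {n : ℕ}, (Fin n → ℝ) → (Fin n → ℝ) →ₗ[ℝ] ℝ := fun d =>
    { toFun := fun v => v ⬝ᵥ d
      map_add' := fun v w => add_dotProduct v w d
      map_smul' := fun c v => smul_dotProduct c v d }
  let D : Fin H → Fin I → Fin J → U →ᵃ[ℝ] (Fin M → ℝ) := fun h i j =>
    (Cᵀ.mulVecLin ∘ₗ γ' h i j).toAffineMap - (a j).comp X'.toAffineMap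
  have e : feasible N X a b C g ξhat = X' ⁻¹' X ∩ ⋂ h, ⋂ i, ⋂ j,
      ({v | ((b j).comp X'.toAffineMap + (dot (ξhat h i)).toAffineMap.comp
          ((a j).comp X'.toAffineMap) + (dot (g - C *ᵥ ξhat h i) ∘ₗ γ' h i j).toAffineMap :
            U →ᵃ[ℝ] ℝ) v ≤ (s' h i).toAffineMap v} ∩
        ({v | AffineMap.const ℝ U (0 : ℝ) v ≤ lam'.toAffineMap v} ∩
          ⋂ m, ({v | ((LinearMap.proj m : (Fin M → ℝ) →ₗ[ℝ] ℝ).toAffineMap.comp (D h i j)) v ≤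
              lam'.toAffineMap v} ∩
            {v | (-(LinearMap.proj m : (Fin M → ℝ) →ₗ[ℝ] ℝ).toAffineMap.comp (D h i j)) v ≤
              lam'.toAffineMap v})) ∩
        ⋂ r, {v | AffineMap.const ℝ U (0 : ℝ) v ≤
          ((LinearMap.proj r : (Fin R → ℝ) →ₗ[ℝ] ℝ) ∘ₗ γ' h i j).toAffineMap v}) := by
    ext ⟨x, lam, s, γ⟩
    simp only [feasible, Set.mem_ofPred_eq, Set.mem_inter_iff, Set.mem_iInter, Set.mem_preimage,
      dualNorm_le_iff_of_l1 N h1, abs_le', Pi.le_def, and_assoc]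
    rfl
  rw [e]
  refine (hX.preimage X').inter (.iInter fun h => .iInter fun i => .iInter fun j => ?_)
  refine ((isPolyhedral_setOf_affine_le _ _).inter ((isPolyhedral_setOf_affine_le _ _).inter
    (.iInter fun m => (isPolyhedral_setOf_affine_le _ _).inter
      (isPolyhedral_setOf_affine_le _ _)))).inter
    (.iInter fun r => isPolyhedral_setOf_affine_le _ _)

end MRDRO

theorem mainTheorem2 {K M H I J R : ℕ} [NeZero I] [NeZero J]
    (N : Seminorm ℝ (Fin M → ℝ)) (hN : ∀ v, N v = 0 → v = 0)
    (X : Set (Fin K → ℝ))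
    (a : Fin J → (Fin K → ℝ) →ᵃ[ℝ] (Fin M → ℝ)) (b : Fin J → (Fin K → ℝ) →ᵃ[ℝ] ℝ)
    (C : Matrix (Fin R) (Fin M) ℝ) (g : Fin R → ℝ)
    (ξhat : Fin H → Fin I → Fin M → ℝ)
    (t : Fin H → ℝ) (ht0 : ∀ h, 0 ≤ t h) (ht1 : ∑ h, t h = 1)
    (hP : MRDRO.empirical t ξhat (MRDRO.uncertaintySet C g)ᶜ = 0)
    (ε : ℝ) (hε : 0 ≤ ε) :
    -- the two problems have the same optimal value
    (⨅ x ∈ X, MRDRO.worstCase N (MRDRO.uncertaintySet C g) ε (MRDRO.empirical t ξhat)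
        (MRDRO.loss a b x))
      = (⨅ v ∈ MRDRO.feasible N X a b C g ξhat, ((MRDRO.objective t ε v : ℝ) : EReal)) ∧
    -- for each fixed decision, the worst-case cost is the value of the program in `(λ, s, γ)`
    (∀ x ∈ X,
      MRDRO.worstCase N (MRDRO.uncertaintySet C g) ε (MRDRO.empirical t ξhat)
          (MRDRO.loss a b x)
        = ⨅ (w : MRDRO.AuxVar H I J R) (_ : (x, w) ∈ MRDRO.feasible N X a b C g ξhat),
            ((MRDRO.objective t ε (x, w) : ℝ) : EReal)) ∧
    -- the optimal decisions are the `x`-parts of the optimal solutions of the program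
    (∀ x : Fin K → ℝ,
      (x ∈ X ∧ IsMinOn (fun y => MRDRO.worstCase N (MRDRO.uncertaintySet C g) ε
          (MRDRO.empirical t ξhat) (MRDRO.loss a b y)) X x) ↔
        ∃ w : MRDRO.AuxVar H I J R, (x, w) ∈ MRDRO.feasible N X a b C g ξhat ∧
          IsMinOn (MRDRO.objective t ε) (MRDRO.feasible N X a b C g ξhat) (x, w)) ∧
    -- for the `ℓ₁` norm the dual norm is `ℓ_∞`, and the program is linear for polyhedral `X`
    ((∀ v, N v = ∑ m, |v m|) →
      (∀ v, MRDRO.dualNorm N v = ⨆ m, |v m|) ∧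
      (MRDRO.IsPolyhedral X →
        MRDRO.IsLinearProgram (MRDRO.feasible N X a b C g ξhat) (MRDRO.objective t ε))) := by
  have hweak := fun {x w} => MRDRO.worstCase_le_objective N X a b C g ξhat t hN ht0 ht1 hε
    (x := x) (w := w)
  have hstrong := fun {x} => MRDRO.exists_objective_le_worstCase N X a b C g ξhat t hN ht0 ht1 hP
    hε (x := x)
  refine ⟨le_antisymm ?_ ?_, fun x hx => le_antisymm ?_ ?_, fun x => ⟨?_, ?_⟩, fun h1 =>
    ⟨MRDRO.dualNorm_eq_iSup_abs_of_l1 N h1, fun hX =>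
      ⟨⟨MRDRO.objectiveLinear t ε, fun v => rfl⟩,
        MRDRO.isPolyhedral_feasible N h1 hX a b C g ξhat⟩⟩⟩
  · exact le_iInf₂ fun v hv => (iInf₂_le v.1 hv.1).trans (hweak hv)
  · refine le_iInf₂ fun x hx => ?_
    obtain ⟨w, hw, hle⟩ := hstrong hx
    exact (iInf₂_le (x, w) hw).trans hle
  · exact le_iInf₂ fun w hw => hweak hw
  · obtain ⟨w, hw, hle⟩ := hstrong hx
    exact (iInf₂_le w hw).trans hle
  -- Attainment is essential here: `w` reaches the worst case at `x`, so minimality of `x` passes to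
  -- `(x, w)`.
  · rintro ⟨hx, hmin⟩
    obtain ⟨w, hw, hle⟩ := hstrong hx
    exact ⟨w, hw, fun v hv => EReal.coe_le_coe_iff.mp
      (hle.trans ((hmin hv.1).trans (hweak hv)))⟩
  · rintro ⟨w, hw, hmin⟩
    refine ⟨hw.1, fun y hy => (hweak hw).trans ?_⟩
    obtain ⟨w', hw', hle⟩ := hstrong hy
    exact (EReal.coe_le_coe_iff.mpr (hmin hw')).trans hle
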